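/- Let $\delta>0$, $0\le\sigma<\infty$ and $g=(g_n)_{n\in\mathbb Z}\in\ell^2$, where $\ell^2=\ell^2(\mathbb Z;\mathbb C)$, and consider the damped, driven discrete nonlinear Schrödinger equation $$i\dot u_n+(u_{n-1}-2u_n+u_{n+1})+i\delta u_n+|u_n|^{2\sigma}u_n=g_n,\qquad n\in\mathbb Z,\ t\ge 0,\qquad u(0)=u_0\in\ell^2 .$$ For every $u_0\in\ell^2$ this problem has exactly one solution $u\in C^1([0,\infty),\ell^2)$, and the maps $S(t)u_0:=u(t)$, $t\ge0$, form a semigroup on $\ell^2$, with $(t,u_0)\mapsto S(t)u_0$ continuous on $[0,\infty)\times\ell^2$. This semigroup possesses a global attractor $\mathcal A\subset\ell^2$, that is, a compact set with $S(t)\mathcal A=\mathcal A$ for all $t\ge0$ and $$\sup_{x\in B}\ \inf_{y\in\mathcal A}\|S(t)x-y\|_{\ell^2}\longrightarrow 0\quad (t\to\infty)\qquad\text{for every bounded } B\subset\ell^2 .$$ The set $\mathcal A$ is non-empty and connected, and it is the largest (with respect to inclusion) among the bounded sets $Y\subset\ell^2$ with $S(t)Y=Y$ for all $t\ge0$. Moreover,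 for every $\rho_1>\|g\|_{\ell^2}/\delta$ the closed ball $\mathcal B_0=\{v\in\ell^2:\|v\|_{\ell^2}\le\rho_1\}$ is absorbing (for every bounded $B\subset\ell^2$ there is $t_0\ge 0$ such that $S(t)B\subset\mathcal B_0$ for all $t\ge t_0$), and $$\mathcal A=\omega(\mathcal B_0)=\bigcap_{s\ge0}\overline{\bigcup_{t\ge s}S(t)\mathcal B_0}\subset\mathcal B_0 .$$ -/

import Mathlib

open scoped NNReal

namespace DNLS

/-- The Hilbert space `ℓ²` of square-summable complex sequences indexed by `ℤ`. -/
abbrev Ell2 : Type := lp (fun _ : ℤ => ℂ) 2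

/-- The discrete Laplacian `(Δu)_n = u_{n-1} - 2 u_n + u_{n+1}`. -/
def laplacian (u : ℤ → ℂ) (n : ℤ) : ℂ := u (n - 1) - 2 * u n + u (n + 1)

/-- `u ∈ C¹([0,∞), ℓ²)` solves
`i u̇_n + (Δu)_n + i δ u_n + |u_n|^{2σ} u_n = g_n` for all `n ∈ ℤ`, `t ≥ 0`, with `u(0) = u₀`.
Only the values of `u` on `[0,∞)` matter. -/
structure IsSolution (δ σ : ℝ) (g u₀ : Ell2) (u : ℝ → Ell2) : Prop where
  contDiffOn : ContDiffOn ℝ 1 u (Set.Ici 0)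
  initial : u 0 = u₀
  equation : ∀ t : ℝ, 0 ≤ t → ∀ n : ℤ,
    Complex.I * (derivWithin u (Set.Ici 0) t) n + laplacian (u t) n
      + Complex.I * (δ : ℂ) * u t n + ((‖u t n‖ ^ (2 * σ) : ℝ) : ℂ) * u t n = g n

/-- `S` is the solution semigroup of the equation: for each `u₀`, the trajectory `t ↦ S(t) u₀` is a
solution starting at `u₀`, and it is the only one. -/
def IsSolutionSemigroup (δ σ : ℝ) (g : Ell2) (S : Flow ℝ≥0 Ell2) : Prop :=
  ∀ (u₀ : Ell2) (u : ℝ → Ell2), IsSolution δ σ g u₀ u ↔ ∀ t : ℝ≥0, u t = S t u₀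

section Semigroup

variable {X : Type*} [PseudoMetricSpace X]

/-- `B₀` absorbs every bounded set after a finite time. -/
def IsAbsorbing (S : Flow ℝ≥0 X) (B₀ : Set X) : Prop :=
  ∀ B : Set X, Bornology.IsBounded B → ∃ t₀ : ℝ≥0, ∀ t : ℝ≥0, t₀ ≤ t → S t '' B ⊆ B₀

/-- `Y` is functional invariant: `S(t) Y = Y` for all `t ≥ 0`. -/
def IsFunctionalInvariant (S : Flow ℝ≥0 X) (Y : Set X) : Prop :=
  ∀ t : ℝ≥0, S t '' Y = Y

/-- `A` attracts every bounded set `B`: the semidistance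
`sup_{x ∈ S(t) B} inf_{y ∈ A} d(x, y)` tends to `0` as `t → ∞`. -/
def AttractsBounded (S : Flow ℝ≥0 X) (A : Set X) : Prop :=
  ∀ B : Set X, Bornology.IsBounded B → ∀ η : ℝ, 0 < η →
    ∃ T : ℝ≥0, ∀ t : ℝ≥0, T ≤ t → S t '' B ⊆ Metric.thickening η A

/-- A global attractor: a compact functional invariant set that attracts every bounded set. -/
structure IsGlobalAttractor (S : Flow ℝ≥0 X) (A : Set X) : Prop where
  isCompact : IsCompact A
  invariant : IsFunctionalInvariant S A
  attracts : AttractsBounded S A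

end Semigroup

end DNLS

/-!
The equation reads `u̇ = F(u)` with `F(u) = i (Δu + |u|^{2σ} u - g) - δ u`, a vector field on `ℓ²`
which is Lipschitz on every ball: sequences in `ℓ²` are bounded by their norm, and
`z ↦ |z|^{2σ} z` is Lipschitz on bounded sets (`exists_lipschitzOnWith_field`).

Everything else rests on one weighted energy inequality, `re_inner_weight_field_le`. For a real
weight `θ` with `|θ| ≤ 1`, put `w = θ u`. Then
`Re ⟪w, θ F(u)⟫ ≤ -δ ‖w‖² + (‖θ g‖ + 2 κ ‖u‖) ‖w‖`, where `κ` bounds the increments of `θ`: the term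
`i |u|^{2σ} u` drops out because it is `i` times a real multiple of `u` at every site, and `i Δ`
because `Δ` is symmetric, up to the commutator of `Δ` with `θ`, of norm at most `2 κ`. By Young's
inequality and integration, `‖w(t)‖² ≤ e^{-δt} ‖w(0)‖² + ((‖θ g‖ + 2 κ sup ‖u‖) / δ)²`.

* With `θ = 1` the field is dissipative. It points inwards on large spheres, which gives global
  existence (`exists_flow_of_dissipative`), and every ball of radius larger than `‖g‖ / δ` is
  absorbing (`isAbsorbing_closedBall`).
* With `θ` vanishing for `|n| ≤ k`, equal to `1` for `|n| ≥ 2k`, and with increments at most `1 / k`,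
  the bound says that for large `k` and `t` the tails of `u(t)` are uniformly small. Hence the orbits
  of a ball approach compact sets of finitely supported sequences
  (`isAsymptoticallyCompact_closedBall`).

In a complete metric space, the `ω`-limit set of an absorbing set with asymptotically compact
orbits is a global attractor (`isGlobalAttractor_omegaLimit`). A global attractor is the greatest
bounded invariant set, so it does not depend on the absorbing ball chosen; it lies in every absorbing
set, and it is connected because it attracts a connected set containing it.
-/

namespace DNLS
open Filter Topology Set Metric

/-! ### Coordinatewise estimates in `ℓ²` -/

lemma norm_le_mul_of_forall {w v : Ell2} {C : ℝ} (hC : 0 ≤ C) (h : ∀ n, ‖w n‖ ≤ C * ‖v n‖) :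
    ‖w‖ ≤ C * ‖v‖ := by
  have h1 : ‖w‖ ≤ ‖(C : ℂ) • v‖ := by
    refine lp.norm_mono (by norm_num) fun n => ?_
    rw [lp.coeFn_smul, Pi.smul_apply, norm_smul, Complex.norm_real, Real.norm_of_nonneg hC]
    exact h n
  rwa [norm_smul, Complex.norm_real, Real.norm_of_nonneg hC] at h1

lemma memℓp_of_le_mul {f : ℤ → ℂ} {v : Ell2} {C : ℝ} (h : ∀ n, ‖f n‖ ≤ C * ‖v n‖) :
    Memℓp f 2 := by
  refine (lp.memℓp ((C : ℂ) • v)).mono' fun n => (h n).trans ?_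
  rw [lp.coeFn_smul, Pi.smul_apply, norm_smul, Complex.norm_real]
  exact mul_le_mul_of_nonneg_right (le_abs_self C) (norm_nonneg (v n))

lemma norm_coord_le (u : Ell2) (n : ℤ) : ‖u n‖ ≤ ‖u‖ :=
  lp.norm_apply_le_norm (by norm_num) u n

lemma re_inner_eq_zero_of_forall {v w : Ell2} (h : ∀ n, (inner ℂ (v n) (w n)).re = 0) :
    (inner ℂ v w).re = 0 := by
  have h1 := Complex.hasSum_re (lp.hasSum_inner (𝕜 := ℂ) v w)
  simp only [h] at h1
  exact h1.unique hasSum_zero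

lemma norm_sq_eq_tsum (u : Ell2) : ‖u‖ ^ 2 = ∑' n, ‖u n‖ ^ 2 := by
  have := lp.norm_rpow_eq_tsum (p := 2) (by norm_num) u
  simpa using this

/-! ### Shifts, the discrete Laplacian and weights -/

/-- The translation `(shift k u)_n = u_{n+k}` on `ℓ²`. -/
noncomputable def shift (k : ℤ) : Ell2 →ₗᵢ[ℂ] Ell2 where
  toFun u := ⟨fun n => u (n + k), by
    refine memℓp_gen ?_
    exact (Equiv.addRight k).summable_iff.2 ((lp.memℓp u).summable (by norm_num))⟩
  map_add' _ _ := rfl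
  map_smul' _ _ := rfl
  norm_map' u := by
    refine (sq_eq_sq₀ (norm_nonneg _) (norm_nonneg _)).1 ?_
    rw [norm_sq_eq_tsum, norm_sq_eq_tsum]
    exact (Equiv.addRight k).tsum_eq fun n => ‖u n‖ ^ 2

@[simp] lemma shift_apply (k : ℤ) (u : Ell2) (n : ℤ) : shift k u n = u (n + k) := rfl

lemma inner_shift_left (k : ℤ) (u v : Ell2) :
    inner ℂ (shift k u) v = inner ℂ u (shift (-k) v) := by
  rw [lp.inner_eq_tsum, lp.inner_eq_tsum, ← (Equiv.addRight (-k)).tsum_eq]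
  simp

/-- The discrete Laplacian as an operator on `ℓ²`. -/
noncomputable def lap (u : Ell2) : Ell2 := shift (-1) u - (2 : ℂ) • u + shift 1 u

@[simp] lemma lap_apply (u : Ell2) (n : ℤ) : lap u n = laplacian u n := by
  rw [laplacian, sub_eq_add_neg n 1]
  rfl

/-- The Laplacian is symmetric, so that `i Δ` does not contribute to the energy balance. -/
lemma re_inner_I_smul_lap (u : Ell2) : (inner ℂ u (Complex.I • lap u)).re = 0 := by
  have h : inner ℂ (lap u) u = inner ℂ u (lap u) := by
    simp only [lap, inner_add_left, inner_sub_left, inner_add_right, inner_sub_right,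
      inner_smul_left, inner_smul_right, inner_shift_left, neg_neg, map_ofNat]
    ring
  rw [← inner_conj_symm] at h
  have h2 := congrArg Complex.im h
  rw [Complex.conj_im] at h2
  rw [inner_smul_right, Complex.I_mul_re]
  linarith

/-- Multiplication of a sequence by a real weight `θ` with `|θ| ≤ 1`. -/
noncomputable def weight (θ : ℤ → ℝ) (hθ : ∀ n, |θ n| ≤ 1) : Ell2 →L[ℂ] Ell2 :=
  LinearMap.mkContinuous
    { toFun := fun u => ⟨fun n => (θ n : ℂ) * u n, memℓp_of_le_mul (v := u) (C := 1) fun n => by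
        simpa using mul_le_mul_of_nonneg_right (hθ n) (norm_nonneg (u n))⟩
      map_add' := fun u v => lp.ext <| funext fun n => mul_add _ _ _
      map_smul' := fun c u => lp.ext <| funext fun n => mul_left_comm _ _ _ } 1 fun u =>
    norm_le_mul_of_forall zero_le_one fun n => by
      simpa using mul_le_mul_of_nonneg_right (hθ n) (norm_nonneg (u n))

@[simp] lemma weight_apply {θ : ℤ → ℝ} (hθ : ∀ n, |θ n| ≤ 1) (u : Ell2) (n : ℤ) :
    weight θ hθ u n = θ n * u n := rfl

lemma norm_weight_le {θ : ℤ → ℝ} (hθ : ∀ n, |θ n| ≤ 1) (u : Ell2) : ‖weight θ hθ u‖ ≤ ‖u‖ := by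
  simpa using norm_le_mul_of_forall (w := weight θ hθ u) (v := u) zero_le_one fun n => by
    simpa using mul_le_mul_of_nonneg_right (hθ n) (norm_nonneg (u n))

lemma norm_weight_shift_sub_le {θ : ℤ → ℝ} (hθ : ∀ n, |θ n| ≤ 1) {κ : ℝ} (hκ : 0 ≤ κ) (k : ℤ)
    (hk : ∀ n, |θ n - θ (n + k)| ≤ κ) (u : Ell2) :
    ‖weight θ hθ (shift k u) - shift k (weight θ hθ u)‖ ≤ κ * ‖u‖ := by
  rw [← (shift k).norm_map u]
  refine norm_le_mul_of_forall hκ fun n => ?_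
  have h : (weight θ hθ (shift k u) - shift k (weight θ hθ u)) n
      = ((θ n - θ (n + k) : ℝ) : ℂ) * shift k u n := by
    simp [sub_mul]
  rw [h, norm_mul, Complex.norm_real]
  exact mul_le_mul_of_nonneg_right (hk n) (norm_nonneg _)

/-- The commutator of the Laplacian with a slowly varying weight is small. -/
lemma norm_weight_lap_sub_le {θ : ℤ → ℝ} (hθ : ∀ n, |θ n| ≤ 1) {κ : ℝ}
    (hk : ∀ n, |θ n - θ (n + 1)| ≤ κ) (u : Ell2) :
    ‖weight θ hθ (lap u) - lap (weight θ hθ u)‖ ≤ 2 * κ * ‖u‖ := by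
  have hκ : 0 ≤ κ := (abs_nonneg _).trans (hk 0)
  have hk' : ∀ n, |θ n - θ (n + -1)| ≤ κ := fun n => by
    have := hk (n + -1)
    rwa [neg_add_cancel_right, abs_sub_comm] at this
  have h : weight θ hθ (lap u) - lap (weight θ hθ u)
      = (weight θ hθ (shift (-1) u) - shift (-1) (weight θ hθ u))
        + (weight θ hθ (shift 1 u) - shift 1 (weight θ hθ u)) := by
    simp only [lap, map_add, map_sub, map_smul]
    abel
  rw [h]
  have h1 := norm_weight_shift_sub_le hθ hκ (-1) hk' u
  have h2 := norm_weight_shift_sub_le hθ hκ 1 hk u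
  linarith [norm_add_le (weight θ hθ (shift (-1) u) - shift (-1) (weight θ hθ u))
    (weight θ hθ (shift 1 u) - shift 1 (weight θ hθ u))]

/-! ### The nonlinearity -/

/-- Bernoulli's inequality in the form of a Lipschitz bound for `r ↦ r ^ (p + 1)`. -/
lemma rpow_mul_sub_le {p r s : ℝ} (hp : 0 ≤ p) (hr : 0 ≤ r) (hrs : r ≤ s) :
    (s ^ p - r ^ p) * r ≤ p * s ^ p * (s - r) := by
  rcases hrs.eq_or_lt with rfl | hlt
  · simp
  have hs : 0 < s := hr.trans_lt hlt
  rcases hr.eq_or_lt with rfl | hr0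
  · simp only [mul_zero]; positivity
  have hb := one_add_mul_self_le_rpow_one_add (s := r / s - 1) (p := p + 1)
    (by have : 0 ≤ r / s := by positivity
        linarith) (by linarith)
  rw [add_sub_cancel, Real.div_rpow hr hs.le, Real.rpow_add_one hr0.ne', Real.rpow_add_one hs.ne',
    le_div_iff₀ (by positivity)] at hb
  have h2 : (1 + (p + 1) * (r / s - 1)) * (s ^ p * s)
      = s ^ p * r - p * s ^ p * (s - r) := by
    field_simp; ring
  linarith

lemma norm_rpow_mul_sub_le {p M : ℝ} (hp : 0 ≤ p) {a b : ℂ} (ha : ‖a‖ ≤ M) (hb : ‖b‖ ≤ M) :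
    ‖((‖a‖ ^ p : ℝ) : ℂ) * a - ((‖b‖ ^ p : ℝ) : ℂ) * b‖ ≤ (p + 1) * M ^ p * ‖a - b‖ := by
  wlog hab : ‖b‖ ≤ ‖a‖ generalizing a b
  · have := this hb ha (not_le.1 hab).le
    rwa [norm_sub_rev, norm_sub_rev b a] at this
  have h1 : ((‖a‖ ^ p : ℝ) : ℂ) * a - ((‖b‖ ^ p : ℝ) : ℂ) * b
      = ((‖a‖ ^ p : ℝ) : ℂ) * (a - b) + ((‖a‖ ^ p - ‖b‖ ^ p : ℝ) : ℂ) * b := by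
    push_cast; ring
  have hmono : ‖b‖ ^ p ≤ ‖a‖ ^ p := Real.rpow_le_rpow (norm_nonneg _) hab hp
  have hM : ‖a‖ ^ p ≤ M ^ p := Real.rpow_le_rpow (norm_nonneg _) ha hp
  have h0 : 0 ≤ ‖a‖ ^ p := Real.rpow_nonneg (norm_nonneg _) _
  rw [h1]
  refine (norm_add_le _ _).trans ?_
  rw [norm_mul, norm_mul, Complex.norm_real, Complex.norm_real, Real.norm_of_nonneg h0,
    Real.norm_of_nonneg (sub_nonneg.2 hmono)]
  calc ‖a‖ ^ p * ‖a - b‖ + (‖a‖ ^ p - ‖b‖ ^ p) * ‖b‖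
      ≤ ‖a‖ ^ p * ‖a - b‖ + p * ‖a‖ ^ p * (‖a‖ - ‖b‖) :=
        add_le_add_right (rpow_mul_sub_le hp (norm_nonneg _) hab) _
    _ ≤ ‖a‖ ^ p * ‖a - b‖ + p * ‖a‖ ^ p * ‖a - b‖ := by
        gcongr; exact norm_sub_norm_le a b
    _ = (p + 1) * ‖a‖ ^ p * ‖a - b‖ := by ring
    _ ≤ (p + 1) * M ^ p * ‖a - b‖ := by gcongr

/-- The power nonlinearity `(|u_n|^p u_n)_n` on `ℓ²`. -/
noncomputable def powNonlin (p : ℝ) (hp : 0 ≤ p) (u : Ell2) : Ell2 :=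
  ⟨fun n => ((‖u n‖ ^ p : ℝ) : ℂ) * u n,
    memℓp_of_le_mul (v := u) (C := ‖u‖ ^ p) fun n => by
      rw [norm_mul, Complex.norm_real, Real.norm_of_nonneg (Real.rpow_nonneg (norm_nonneg _) _)]
      gcongr
      exact norm_coord_le u n⟩

@[simp] lemma powNonlin_apply {p : ℝ} (hp : 0 ≤ p) (u : Ell2) (n : ℤ) :
    powNonlin p hp u n = ((‖u n‖ ^ p : ℝ) : ℂ) * u n := rfl

lemma norm_powNonlin_sub_le {p R : ℝ} (hp : 0 ≤ p) {u v : Ell2} (hu : ‖u‖ ≤ R) (hv : ‖v‖ ≤ R) :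
    ‖powNonlin p hp u - powNonlin p hp v‖ ≤ (p + 1) * R ^ p * ‖u - v‖ := by
  have hR : 0 ≤ R := (norm_nonneg u).trans hu
  refine norm_le_mul_of_forall (by positivity) fun n => ?_
  exact norm_rpow_mul_sub_le hp ((norm_coord_le u n).trans hu) ((norm_coord_le v n).trans hv)

/-! ### The vector field -/

/-- The vector field `F(u) = i (Δu + |u|^{2σ} u - g) - δ u` for which the equation reads
`u̇ = F(u)`. -/
noncomputable def field (δ σ : ℝ) (hσ : 0 ≤ σ) (g u : Ell2) : Ell2 :=
  Complex.I • (lap u + powNonlin (2 * σ) (by positivity) u - g) - (δ : ℂ) • u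

lemma eq_field_iff {δ σ : ℝ} (hσ : 0 ≤ σ) {g u w : Ell2} :
    (∀ n : ℤ, Complex.I * w n + laplacian u n + Complex.I * (δ : ℂ) * u n
      + ((‖u n‖ ^ (2 * σ) : ℝ) : ℂ) * u n = g n) ↔ w = field δ σ hσ g u := by
  rw [lp.ext_iff, funext_iff]
  refine forall_congr' fun n => ?_
  simp only [field, lp.coeFn_sub, lp.coeFn_smul, lp.coeFn_add, Pi.sub_apply, Pi.smul_apply,
    Pi.add_apply, lap_apply, powNonlin_apply, smul_eq_mul]
  constructor
  · intro h
    linear_combination (-Complex.I) * h + (w n + δ * u n) * Complex.I_mul_I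
  · intro h
    linear_combination Complex.I * h + (laplacian u n +
      ((‖u n‖ ^ (2 * σ) : ℝ) : ℂ) * u n - g n) * Complex.I_mul_I

lemma exists_lipschitzOnWith_field (δ : ℝ) {σ : ℝ} (hσ : 0 ≤ σ) (g : Ell2) (R : ℝ) :
    ∃ K : ℝ≥0, LipschitzOnWith K (field δ σ hσ g) (closedBall 0 R) := by
  have hp : 0 ≤ 2 * σ := by positivity
  refine ⟨(4 + (2 * σ + 1) * R ^ (2 * σ) + |δ|).toNNReal,
    LipschitzOnWith.of_dist_le_mul fun u hu v hv => ?_⟩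
  rw [mem_closedBall_zero_iff] at hu hv
  have hN := norm_powNonlin_sub_le hp hu hv
  have hL : ‖lap u - lap v‖ ≤ 4 * ‖u - v‖ := by
    have h : lap u - lap v = shift (-1) (u - v) - (2 : ℂ) • (u - v) + shift 1 (u - v) := by
      simp only [lap, map_sub, smul_sub]; abel
    rw [h]
    refine (norm_add_le _ _).trans ((add_le_add_left (norm_sub_le _ _) _).trans ?_)
    simp only [LinearIsometry.norm_map, norm_smul, Complex.norm_ofNat]
    linarith
  have hF : field δ σ hσ g u - field δ σ hσ g v
      = Complex.I • ((lap u - lap v) + (powNonlin (2 * σ) hp u - powNonlin (2 * σ) hp v))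
        - (δ : ℂ) • (u - v) := by
    simp only [field, smul_sub, smul_add]; abel
  rw [dist_eq_norm, dist_eq_norm, hF]
  refine (norm_sub_le _ _).trans ?_
  rw [norm_smul, norm_smul, Complex.norm_I, Complex.norm_real, Real.norm_eq_abs, one_mul]
  have h1 := norm_add_le (lap u - lap v) (powNonlin (2 * σ) hp u - powNonlin (2 * σ) hp v)
  have h2 := mul_le_mul_of_nonneg_right
    (Real.le_coe_toNNReal (4 + (2 * σ + 1) * R ^ (2 * σ) + |δ|)) (norm_nonneg (u - v))
  linarith

/-- The weighted energy inequality. The Laplacian enters only through its commutator with the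
weight, and the nonlinearity not at all, being a real multiple of `u` at each site. -/
lemma re_inner_weight_field_le {δ σ : ℝ} (hσ : 0 ≤ σ) (g : Ell2) {θ : ℤ → ℝ}
    (hθ : ∀ n, |θ n| ≤ 1) {κ : ℝ} (hk : ∀ n, |θ n - θ (n + 1)| ≤ κ) (u : Ell2) :
    (inner ℂ (weight θ hθ u) (weight θ hθ (field δ σ hσ g u))).re ≤
      -δ * ‖weight θ hθ u‖ ^ 2 + (‖weight θ hθ g‖ + 2 * κ * ‖u‖) * ‖weight θ hθ u‖ := by
  have hp : 0 ≤ 2 * σ := by positivity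
  set w := weight θ hθ u with hw
  set c := weight θ hθ (lap u) - lap w with hc
  have hF : weight θ hθ (field δ σ hσ g u) = Complex.I • lap w + Complex.I • c
      + Complex.I • weight θ hθ (powNonlin (2 * σ) hp u) - Complex.I • weight θ hθ g
      - (δ : ℂ) • w := by
    simp only [field, map_sub, map_smul, map_add, smul_sub, smul_add, hc, hw]; abel
  have hN : (inner ℂ w (Complex.I • weight θ hθ (powNonlin (2 * σ) hp u))).re = 0 := by
    refine re_inner_eq_zero_of_forall fun n => ?_
    simp only [hw, lp.coeFn_smul, Pi.smul_apply, weight_apply, powNonlin_apply, smul_eq_mul,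
      RCLike.inner_apply, map_mul, Complex.conj_ofReal]
    simp only [Complex.mul_re, Complex.mul_im, Complex.I_re, Complex.I_im, Complex.ofReal_re,
      Complex.ofReal_im, Complex.conj_re, Complex.conj_im]
    ring
  have hcb : (inner ℂ w (Complex.I • c)).re ≤ ‖w‖ * (2 * κ * ‖u‖) := by
    refine (re_inner_le_norm (𝕜 := ℂ) w (Complex.I • c)).trans ?_
    rw [norm_smul, Complex.norm_I, one_mul]
    exact mul_le_mul_of_nonneg_left (norm_weight_lap_sub_le hθ hk u) (norm_nonneg _)
  have hgb : -(inner ℂ w (Complex.I • weight θ hθ g)).re ≤ ‖w‖ * ‖weight θ hθ g‖ := by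
    have := re_inner_le_norm (𝕜 := ℂ) w (-(Complex.I • weight θ hθ g))
    rwa [inner_neg_right, map_neg, norm_neg, norm_smul, Complex.norm_I, one_mul] at this
  have hd : (inner ℂ w ((δ : ℂ) • w)).re = δ * ‖w‖ ^ 2 := by
    rw [inner_smul_right, Complex.re_ofReal_mul, inner_self_eq_norm_sq_to_K]
    norm_cast
  rw [hF]
  simp only [inner_sub_right, inner_add_right, Complex.sub_re, Complex.add_re,
    re_inner_I_smul_lap, hN, hd]
  linarith

/-! ### Autonomous equations with a dissipative, locally Lipschitz vector field -/

section ODE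
variable {E : Type*} [NormedAddCommGroup E] [NormedSpace ℝ E]

/-- `u` is a forward trajectory of the vector field `F` on `[0,∞)`. -/
def IsTrajectory (F : E → E) (u : ℝ → E) : Prop :=
  ∀ t : ℝ, 0 ≤ t → HasDerivWithinAt u (F (u t)) (Ici 0) t

/-- The radial retraction onto the closed ball of radius `R`. -/
noncomputable def radialRetract (R : ℝ) (u : E) : E := (R / max R ‖u‖) • u

lemma radialRetract_of_norm_le {R : ℝ} (hR : 0 < R) {u : E} (hu : ‖u‖ ≤ R) :
    radialRetract R u = u := by
  rw [radialRetract, max_eq_left hu, div_self hR.ne', one_smul]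

lemma norm_radialRetract_le {R : ℝ} (hR : 0 < R) (u : E) : ‖radialRetract R u‖ ≤ R := by
  have hm : 0 < max R ‖u‖ := hR.trans_le (le_max_left _ _)
  rw [radialRetract, norm_smul, Real.norm_of_nonneg (by positivity), div_mul_eq_mul_div,
    div_le_iff₀ hm]
  exact mul_le_mul_of_nonneg_left (le_max_right _ _) hR.le

lemma lipschitzWith_radialRetract {R : ℝ} (hR : 0 < R) :
    LipschitzWith 2 (radialRetract R : E → E) := by
  refine LipschitzWith.of_dist_le_mul fun u v => ?_
  rw [dist_eq_norm, dist_eq_norm]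
  set a := max R ‖u‖ with ha
  set b := max R ‖v‖ with hb
  have ha0 : 0 < a := hR.trans_le (le_max_left _ _)
  have hb0 : 0 < b := hR.trans_le (le_max_left _ _)
  have hab : |b - a| ≤ ‖u - v‖ := by
    refine (abs_max_sub_max_le_max R ‖v‖ R ‖u‖).trans ?_
    rw [sub_self, abs_zero, max_eq_right (abs_nonneg _), abs_sub_comm]
    exact abs_norm_sub_norm_le u v
  have h : radialRetract R u - radialRetract R v
      = (R / a) • (u - v) + (R / a * ((b - a) / b)) • v := by
    have h2 : R / b = R / a - R / a * ((b - a) / b) := by field_simp; ring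
    simp only [radialRetract, ← ha, ← hb]
    rw [h2, sub_smul, smul_sub]; abel
  have hRa : R / a ≤ 1 := (div_le_one ha0).2 (le_max_left _ _)
  have hvb : ‖v‖ / b ≤ 1 := (div_le_one hb0).2 (le_max_right _ _)
  rw [h]
  refine (norm_add_le _ _).trans ?_
  rw [norm_smul, norm_smul, Real.norm_of_nonneg (by positivity : 0 ≤ R / a), norm_mul,
    Real.norm_of_nonneg (by positivity : 0 ≤ R / a), norm_div, Real.norm_of_nonneg hb0.le, Real.norm_eq_abs]
  have h1 : R / a * ‖u - v‖ ≤ 1 * ‖u - v‖ := by gcongr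
  have h2 : R / a * (|b - a| / b) * ‖v‖ ≤ 1 * ‖u - v‖ * 1 := by
    calc R / a * (|b - a| / b) * ‖v‖ = R / a * |b - a| * (‖v‖ / b) := by ring
      _ ≤ 1 * ‖u - v‖ * 1 := by gcongr
  push_cast
  linarith

lemma IsTrajectory.continuousOn {F : E → E} {u : ℝ → E} (hu : IsTrajectory F u) :
    ContinuousOn u (Ici 0) := fun t ht => (hu t ht).continuousWithinAt

lemma dist_le_of_hasDerivWithinAt {F : E → E} {R T : ℝ} {K : ℝ≥0}
    (hK : LipschitzOnWith K F (closedBall 0 R)) {u v : ℝ → E}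
    (hu : ∀ t ∈ Icc 0 T, ‖u t‖ ≤ R ∧ HasDerivWithinAt u (F (u t)) (Icc 0 T) t)
    (hv : ∀ t ∈ Icc 0 T, ‖v t‖ ≤ R ∧ HasDerivWithinAt v (F (v t)) (Icc 0 T) t) :
    ∀ t ∈ Icc 0 T, dist (u t) (v t) ≤ dist (u 0) (v 0) * Real.exp (K * t) := by
  intro t ht
  have hI : ∀ s ∈ Ico 0 T, Icc 0 T ∈ 𝓝[Ici s] s := fun s hs =>
    mem_of_superset (Icc_mem_nhdsGE hs.2) (Icc_subset_Icc_left hs.1)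
  have := dist_le_of_trajectories_ODE_of_mem (v := fun _ => F) (s := fun _ => closedBall 0 R)
    (K := K) (f := u) (g := v) (a := 0) (b := T) (δ := dist (u 0) (v 0)) (fun _ _ => hK)
    (fun s hs => (hu s hs).2.continuousWithinAt)
    (fun s hs => (hu s (Ico_subset_Icc_self hs)).2.mono_of_mem_nhdsWithin (hI s hs))
    (fun s hs => mem_closedBall_zero_iff.2 (hu s (Ico_subset_Icc_self hs)).1)
    (fun s hs => (hv s hs).2.continuousWithinAt)
    (fun s hs => (hv s (Ico_subset_Icc_self hs)).2.mono_of_mem_nhdsWithin (hI s hs))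
    (fun s hs => mem_closedBall_zero_iff.2 (hv s (Ico_subset_Icc_self hs)).1) le_rfl t ht
  simpa using this

/-- Lipschitz dependence on the initial value, for trajectories that stay in a common ball. -/
lemma IsTrajectory.dist_le {F : E → E} {R T : ℝ} {K : ℝ≥0}
    (hK : LipschitzOnWith K F (closedBall 0 R)) {u v : ℝ → E}
    (hu : IsTrajectory F u) (hv : IsTrajectory F v) (huR : ∀ t ∈ Icc 0 T, ‖u t‖ ≤ R)
    (hvR : ∀ t ∈ Icc 0 T, ‖v t‖ ≤ R) :
    ∀ t ∈ Icc 0 T, dist (u t) (v t) ≤ dist (u 0) (v 0) * Real.exp (K * t) :=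
  dist_le_of_hasDerivWithinAt hK
    (fun t ht => ⟨huR t ht, (hu t ht.1).mono Icc_subset_Ici_self⟩)
    fun t ht => ⟨hvR t ht, (hv t ht.1).mono Icc_subset_Ici_self⟩

lemma IsTrajectory.eqOn {F : E → E}
    (hF : ∀ R : ℝ, ∃ K : ℝ≥0, LipschitzOnWith K F (closedBall 0 R)) {u v : ℝ → E}
    (hu : IsTrajectory F u) (hv : IsTrajectory F v) (h0 : u 0 = v 0) : EqOn u v (Ici 0) := by
  intro t ht
  obtain ⟨R₁, hR₁⟩ := isCompact_Icc.exists_bound_of_continuousOn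
    (hu.continuousOn.mono (Icc_subset_Ici_self : Icc 0 t ⊆ Ici 0))
  obtain ⟨R₂, hR₂⟩ := isCompact_Icc.exists_bound_of_continuousOn
    (hv.continuousOn.mono (Icc_subset_Ici_self : Icc 0 t ⊆ Ici 0))
  obtain ⟨K, hK⟩ := hF (max R₁ R₂)
  have := hu.dist_le hK hv (fun s hs => (hR₁ s hs).trans (le_max_left _ _))
    (fun s hs => (hR₂ s hs).trans (le_max_right _ _)) t ⟨ht, le_rfl⟩
  rw [h0, dist_self, zero_mul] at this
  exact dist_le_zero.1 this

lemma IsTrajectory.shift {F : E → E} {u : ℝ → E} (hu : IsTrajectory F u) {s : ℝ} (hs : 0 ≤ s) :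
    IsTrajectory F fun t => u (t + s) := by
  intro t ht
  have h := (hu (t + s) (add_nonneg ht hs)).scomp t
    ((hasDerivWithinAt_id t (Ici 0)).add_const s) fun r hr => add_nonneg hr hs
  rw [one_smul] at h
  exact h

section Inner
variable [InnerProductSpace ℂ E]

lemma HasDerivWithinAt.norm_sq_complex {w : ℝ → E} {w' : E} {s : Set ℝ} {t : ℝ}
    [IsScalarTower ℝ ℂ E]
    (h : HasDerivWithinAt w w' s t) :
    HasDerivWithinAt (fun t => ‖w t‖ ^ 2) (2 * (inner ℂ (w t) w').re) s t := by
  have h1 := Complex.reCLM.hasFDerivAt.comp_hasDerivWithinAt t (h.inner ℂ h)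
  have h2 : (Complex.reCLM ∘ fun t => inner ℂ (w t) (w t)) = fun t => ‖w t‖ ^ 2 := by
    funext t
    simp only [Function.comp_apply, inner_self_eq_norm_sq_to_K]
    norm_cast
  rw [h2] at h1
  refine h1.congr_deriv ?_
  have h3 : (inner ℂ w' (w t)).re = (inner ℂ (w t) w').re := inner_re_symm (𝕜 := ℂ) w' (w t)
  simp only [Complex.reCLM_apply, Complex.add_re, h3]
  ring

/-- Solutions exist on `[0,T]` in any ball on whose boundary the field points inwards: cut the field
off by the radial retraction, which makes it bounded, so that a single Picard iteration covers the
whole of `[0,T]`. -/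
lemma exists_solution_Icc [IsScalarTower ℝ ℂ E] [CompleteSpace E] {F : E → E} {R : ℝ} (hR : 0 < R)
    {K : ℝ≥0} (hK : LipschitzOnWith K F (closedBall 0 R))
    (hin : ∀ v : E, ‖v‖ = R → (inner ℂ v (F v)).re < 0) {u₀ : E} (hu₀ : ‖u₀‖ ≤ R) {T : ℝ}
    (hT : 0 ≤ T) :
    ∃ v : ℝ → E, v 0 = u₀ ∧
      ∀ t ∈ Icc 0 T, ‖v t‖ ≤ R ∧ HasDerivWithinAt v (F (v t)) (Icc 0 T) t := by
  set G : E → E := fun v => F (radialRetract R v) with hG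
  have hmem : ∀ v : E, radialRetract R v ∈ closedBall (0 : E) R := fun v =>
    mem_closedBall_zero_iff.2 (norm_radialRetract_le hR v)
  have hGK : LipschitzWith (K * 2) G :=
    lipschitzOnWith_univ.1 (hK.comp ((lipschitzWith_radialRetract hR).lipschitzOnWith (s := univ))
      fun v _ => hmem v)
  have hL0 : 0 ≤ ‖F 0‖ + K * R := by positivity
  have hGL : ∀ v, ‖G v‖ ≤ ‖F 0‖ + K * R := fun v => by
    have h1 := hK.dist_le_mul _ (hmem v) 0 (mem_closedBall_self hR.le)
    rw [dist_zero_right, dist_eq_norm] at h1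
    have h2 : (K : ℝ) * ‖radialRetract R v‖ ≤ K * R :=
      mul_le_mul_of_nonneg_left (norm_radialRetract_le hR v) K.2
    linarith [norm_le_norm_add_norm_sub' (F (radialRetract R v)) (F 0)]
  have hPL : IsPicardLindelof (fun _ => G) (tmin := 0) (tmax := T) ⟨0, le_rfl, hT⟩ u₀
      (⟨_, hL0⟩ * ⟨T, hT⟩) 0 ⟨_, hL0⟩ (K * 2) :=
    { lipschitzOnWith := fun _ _ => hGK.lipschitzOnWith
      continuousOn := fun _ _ => continuousOn_const
      norm_le := fun _ _ v _ => hGL v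
      mul_max_le := by
        rw [sub_self, sub_zero, max_eq_left hT, NNReal.coe_zero, sub_zero]
        rfl }
  obtain ⟨v, hv0, hv⟩ := hPL.exists_eq_forall_mem_Icc_hasDerivWithinAt₀
  replace hv0 : v 0 = u₀ := hv0
  have hb : ∀ t ∈ Icc 0 T, ‖v t‖ ^ 2 ≤ R ^ 2 := by
    have hIci : ∀ t ∈ Ico 0 T, Icc 0 T ∈ 𝓝[Ici t] t := fun t ht =>
      mem_of_superset (Icc_mem_nhdsGE ht.2) (Icc_subset_Icc_left ht.1)
    refine image_le_of_deriv_right_lt_deriv_boundary (B := fun _ => R ^ 2) (B' := fun _ => 0)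
      (f' := fun t => 2 * (inner ℂ (v t) (G (v t))).re)
      (fun t ht => (HasDerivWithinAt.norm_sq_complex (hv t ht)).continuousWithinAt)
      (fun t ht => (HasDerivWithinAt.norm_sq_complex
        (hv t (Ico_subset_Icc_self ht))).mono_of_mem_nhdsWithin (hIci t ht))
      ?_ (fun t => hasDerivAt_const t _) ?_
    · rw [hv0]
      exact pow_le_pow_left₀ (norm_nonneg _) hu₀ 2
    · intro t _ ht
      have hn : ‖v t‖ = R := (sq_eq_sq₀ (norm_nonneg _) hR.le).1 ht
      have := hin (v t) hn
      simp only [hG, radialRetract_of_norm_le hR hn.le]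
      linarith
  refine ⟨v, hv0, fun t ht => ?_⟩
  have hn : ‖v t‖ ≤ R := (sq_le_sq₀ (norm_nonneg _) hR.le).1 (hb t ht)
  refine ⟨hn, ?_⟩
  have := hv t ht
  simp only [hG] at this
  rwa [radialRetract_of_norm_le hR hn] at this

/-- Global existence for dissipative fields. -/
lemma exists_isTrajectory [IsScalarTower ℝ ℂ E] [CompleteSpace E] {F : E → E} {δ γ : ℝ} (hδ : 0 < δ)
    (hF : ∀ R : ℝ, ∃ K : ℝ≥0, LipschitzOnWith K F (closedBall 0 R))
    (hdiss : ∀ v : E, (inner ℂ v (F v)).re ≤ -δ * ‖v‖ ^ 2 + γ * ‖v‖) (u₀ : E) :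
    ∃ u : ℝ → E, u 0 = u₀ ∧ IsTrajectory F u := by
  -- On the sphere of radius `R > γ / δ` the field points inwards.
  set R := max (‖u₀‖ + 1) (γ / δ + 1) with hRdef
  have hR : 0 < R := (by positivity : 0 < ‖u₀‖ + 1).trans_le (le_max_left _ _)
  have hu₀ : ‖u₀‖ ≤ R := (le_add_of_nonneg_right zero_le_one).trans (le_max_left _ _)
  have hRγ : γ < δ * R := by
    rw [← div_lt_iff₀' hδ]
    exact (lt_add_one _).trans_le (le_max_right _ _)
  have hin : ∀ v : E, ‖v‖ = R → (inner ℂ v (F v)).re < 0 := fun v hv => by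
    refine (hdiss v).trans_lt ?_
    rw [hv]
    nlinarith
  obtain ⟨K, hK⟩ := hF R
  choose v hv0 hv using fun n : ℕ => exists_solution_Icc hR hK hin hu₀ (Nat.cast_nonneg (α := ℝ) n)
  have hcons : ∀ m n : ℕ, m ≤ n → ∀ t ∈ Icc (0 : ℝ) m, v m t = v n t := by
    intro m n hmn t ht
    have hsub : Icc (0 : ℝ) m ⊆ Icc (0 : ℝ) n := Icc_subset_Icc_right (by exact_mod_cast hmn)
    have := dist_le_of_hasDerivWithinAt hK (hv m)
      (fun s hs => ⟨(hv n s (hsub hs)).1, (hv n s (hsub hs)).2.mono hsub⟩) t ht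
    rw [hv0, hv0, dist_self, zero_mul] at this
    exact dist_le_zero.1 this
  have hu : ∀ (n : ℕ), ∀ t ∈ Icc (0 : ℝ) n, v ⌈t⌉₊ t = v n t := fun n t ht =>
    hcons _ _ (Nat.ceil_le.2 ht.2) t ⟨ht.1, Nat.le_ceil t⟩
  refine ⟨fun t => v ⌈t⌉₊ t, by simpa using hv0 0, fun t ht => ?_⟩
  obtain ⟨n, hn⟩ := exists_nat_gt t
  have htn : t ∈ Icc (0 : ℝ) n := ⟨ht, hn.le⟩
  have hnhds : Icc (0 : ℝ) n ∈ 𝓝[Ici 0] t := by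
    rw [← Ici_inter_Iic]
    exact inter_mem_nhdsWithin _ (Iic_mem_nhds hn)
  have h1 := ((hv n t htn).2.congr (hu n) (hu n t htn)).mono_of_mem_nhdsWithin hnhds
  simpa only [hu n t htn] using h1

/-- Decay of a quadratic quantity along a trajectory, from a differential inequality. -/
lemma IsTrajectory.norm_sq_le [IsScalarTower ℝ ℂ E] {F : E → E} {u : ℝ → E}
    (hu : IsTrajectory F u) (W : E →L[ℝ] E) {δ γ : ℝ} (hδ : 0 < δ) {T : ℝ}
    (hW : ∀ t ∈ Icc 0 T,
      (inner ℂ (W (u t)) (W (F (u t)))).re ≤ -δ * ‖W (u t)‖ ^ 2 + γ * ‖W (u t)‖) :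
    ∀ t ∈ Icc 0 T, ‖W (u t)‖ ^ 2 ≤ Real.exp (-δ * t) * ‖W (u 0)‖ ^ 2 + (γ / δ) ^ 2 := by
  have hw : ∀ t, 0 ≤ t → HasDerivWithinAt (fun t => W (u t)) (W (F (u t))) (Ici 0) t :=
    fun t ht => W.hasFDerivAt.comp_hasDerivWithinAt t (hu t ht)
  set φ : ℝ → ℝ := fun t => Real.exp (δ * t) * (‖W (u t)‖ ^ 2 - (γ / δ) ^ 2) with hφ
  have hφd : ∀ t, 0 ≤ t → HasDerivWithinAt φ
      (Real.exp (δ * t) * (δ * 1) * (‖W (u t)‖ ^ 2 - (γ / δ) ^ 2)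
        + Real.exp (δ * t) * (2 * (inner ℂ (W (u t)) (W (F (u t)))).re)) (Ici 0) t := fun t ht =>
    (((hasDerivAt_id t).const_mul δ).exp.hasDerivWithinAt).mul
      ((HasDerivWithinAt.norm_sq_complex (hw t ht)).sub_const _)
  have hanti : AntitoneOn φ (Icc 0 T) := by
    refine antitoneOn_of_hasDerivWithinAt_nonpos (convex_Icc 0 T)
      (fun t ht => (hφd t ht.1).continuousWithinAt.mono Icc_subset_Ici_self)
      (fun t ht => (hφd t (interior_subset ht).1).mono
        (interior_subset.trans Icc_subset_Ici_self)) fun t ht => ?_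
    have h1 := hW t (interior_subset ht)
    set y := ‖W (u t)‖
    -- Young's inequality `2 γ y ≤ δ y² + γ² / δ`.
    have h2 : 2 * γ * y ≤ δ * y ^ 2 + δ * (γ / δ) ^ 2 := by
      have h3 : 0 ≤ δ * (y - γ / δ) ^ 2 := by positivity
      have h4 : δ * (y - γ / δ) ^ 2 = δ * y ^ 2 - 2 * γ * y + δ * (γ / δ) ^ 2 := by
        field_simp; ring
      linarith
    rw [mul_assoc, ← mul_add]
    refine mul_nonpos_of_nonneg_of_nonpos (Real.exp_pos _).le ?_
    linarith
  intro t ht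
  have h := hanti ⟨le_rfl, ht.1.trans ht.2⟩ ht ht.1
  simp only [hφ, mul_zero, Real.exp_zero, one_mul] at h
  have he : Real.exp (-δ * t) * Real.exp (δ * t) = 1 := by
    rw [← Real.exp_add]; simp
  have h5 := mul_le_mul_of_nonneg_left h (Real.exp_pos (-δ * t)).le
  rw [← mul_assoc, he, one_mul] at h5
  nlinarith [mul_nonneg (Real.exp_pos (-δ * t)).le (sq_nonneg (γ / δ))]

/-- A dissipative, locally Lipschitz field generates a continuous semigroup. -/
theorem exists_flow_of_dissipative [IsScalarTower ℝ ℂ E] [CompleteSpace E] {F : E → E} {δ γ : ℝ}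
    (hδ : 0 < δ)
    (hF : ∀ R : ℝ, ∃ K : ℝ≥0, LipschitzOnWith K F (closedBall 0 R))
    (hdiss : ∀ v : E, (inner ℂ v (F v)).re ≤ -δ * ‖v‖ ^ 2 + γ * ‖v‖) :
    ∃ S : Flow ℝ≥0 E, ∀ (u₀ : E) (u : ℝ → E),
      (u 0 = u₀ ∧ IsTrajectory F u) ↔ ∀ t : ℝ≥0, u t = S t u₀ := by
  choose φ hφ0 hφ using exists_isTrajectory hδ hF hdiss
  have hbound : ∀ u₀ t, 0 ≤ t → ‖φ u₀ t‖ ^ 2 ≤ ‖u₀‖ ^ 2 + (γ / δ) ^ 2 := by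
    intro u₀ t ht
    have h := (hφ u₀).norm_sq_le (ContinuousLinearMap.id ℝ E) (γ := γ) hδ (T := t)
      (fun s _ => hdiss _) t ⟨ht, le_rfl⟩
    simp only [ContinuousLinearMap.id_apply, hφ0] at h
    have he : Real.exp (-δ * t) ≤ 1 := Real.exp_le_one_iff.2 (by nlinarith)
    nlinarith [sq_nonneg ‖u₀‖]
  have hadd : ∀ (s t : ℝ) (u₀ : E), 0 ≤ s → 0 ≤ t → φ u₀ (s + t) = φ (φ u₀ t) s :=
    fun s t u₀ hs ht =>
      ((hφ u₀).shift ht).eqOn hF (hφ (φ u₀ t)) (by simp [hφ0]) hs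
  have hcont : Continuous (Function.uncurry fun (t : ℝ≥0) (x : E) => φ x t) := by
    rw [continuous_iff_continuousAt]
    rintro ⟨t, x⟩
    -- Trajectories from the unit ball around `x` share a ball, hence a Lipschitz constant.
    set R := Real.sqrt ((‖x‖ + 1) ^ 2 + (γ / δ) ^ 2) with hR
    obtain ⟨K, hK⟩ := hF R
    have hRb : ∀ y ∈ ball x 1, ∀ s, 0 ≤ s → ‖φ y s‖ ≤ R := fun y hy s hs => by
      refine Real.le_sqrt_of_sq_le ((hbound y s hs).trans ?_)
      have h1 : ‖y‖ ≤ ‖x‖ + 1 := by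
        have := norm_le_norm_add_norm_sub' y x
        rw [mem_ball, dist_eq_norm] at hy
        linarith
      gcongr
    rw [ContinuousAt, tendsto_iff_dist_tendsto_zero]
    have hlim : Tendsto (fun p : ℝ≥0 × E => dist p.2 x * Real.exp (K * p.1)
        + dist (φ x p.1) (φ x t)) (𝓝 (t, x)) (𝓝 0) := by
      have hc : Continuous fun s : ℝ≥0 => φ x s :=
        (hφ x).continuousOn.comp_continuous NNReal.continuous_coe fun s => s.2
      have : Continuous fun p : ℝ≥0 × E => dist p.2 x * Real.exp (K * p.1)
          + dist (φ x p.1) (φ x t) :=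
        ((continuous_snd.dist continuous_const).mul (Real.continuous_exp.comp
          (continuous_const.mul (NNReal.continuous_coe.comp continuous_fst)))).add
          ((hc.comp continuous_fst).dist continuous_const)
      simpa using this.tendsto (t, x)
    refine squeeze_zero' (Eventually.of_forall fun _ => dist_nonneg) ?_ hlim
    have hev : ∀ᶠ p : ℝ≥0 × E in 𝓝 (t, x), p.2 ∈ ball x 1 :=
      continuous_snd.continuousAt.eventually (ball_mem_nhds x one_pos)
    filter_upwards [hev] with p hp
    refine (dist_triangle _ (φ x p.1) _).trans (add_le_add_left ?_ _)
    have := (hφ p.2).dist_le hK (hφ x) (T := p.1) (fun s hs => hRb _ hp s hs.1)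
      (fun s hs => hRb _ (mem_ball_self one_pos) s hs.1) p.1 ⟨p.1.2, le_rfl⟩
    rw [hφ0, hφ0] at this
    exact this
  refine ⟨⟨fun t x => φ x t, hcont, fun s t x => hadd s t x s.2 t.2, fun x => hφ0 x⟩,
    fun u₀ u => ⟨?_, ?_⟩⟩
  · rintro ⟨h0, hu⟩ t
    exact hu.eqOn hF (hφ u₀) (by rw [h0, hφ0]) t.2
  · intro h
    replace h : ∀ t : ℝ≥0, u t = φ u₀ t := h
    have h' : EqOn u (φ u₀) (Ici 0) := fun t ht => h ⟨t, ht⟩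
    refine ⟨(h' self_mem_Ici).trans (hφ0 u₀), fun t ht => ?_⟩
    rw [h' ht]
    exact (hφ u₀ t ht).congr h' (h' ht)

end Inner
end ODE

/-! ### Global attractors of asymptotically compact semigroups -/

section Attractor
variable {X : Type*} [MetricSpace X]

/-- Asymptotic compactness of the orbits issuing from `B`: at large times they lie arbitrarily close
to compact sets. -/
def IsAsymptoticallyCompact (S : Flow ℝ≥0 X) (B : Set X) : Prop :=
  ∀ ε : ℝ, 0 < ε → ∃ K : Set X, IsCompact K ∧
    ∃ T : ℝ≥0, ∀ t : ℝ≥0, T ≤ t → S t '' B ⊆ thickening ε K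

variable {S : Flow ℝ≥0 X} {B : Set X}

lemma exists_of_mem_omegaLimit {x : X} (hx : x ∈ omegaLimit atTop S B) (T : ℝ≥0) {ε : ℝ}
    (hε : 0 < ε) : ∃ t, T ≤ t ∧ ∃ b ∈ B, dist x (S t b) < ε := by
  have h := mem_iInter₂.1 hx (Ici T) (Ici_mem_atTop T)
  obtain ⟨y, ⟨t, ht, b, hb, rfl⟩, hy⟩ := Metric.mem_closure_iff.1 h ε hε
  exact ⟨t, ht, b, hb, hy⟩

/-- Along times tending to infinity, an asymptotically compact family of orbits has a convergent
subsequence, whose limit lies in the `ω`-limit set. -/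
lemma IsAsymptoticallyCompact.exists_subseq [CompleteSpace X] (h : IsAsymptoticallyCompact S B)
    {t : ℕ → ℝ≥0} (ht : Tendsto t atTop atTop) {b : ℕ → X} (hb : ∀ n, b n ∈ B) :
    ∃ y ∈ omegaLimit atTop S B, ∃ φ : ℕ → ℕ, StrictMono φ ∧
      Tendsto (fun n => S (t (φ n)) (b (φ n))) atTop (𝓝 y) := by
  have htb : TotallyBounded (range fun n => S (t n) (b n)) := by
    rw [Metric.totallyBounded_iff]
    intro ε hε
    obtain ⟨K, hK, T, hT⟩ := h (ε / 2) (half_pos hε)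
    obtain ⟨c, hc, hKc⟩ := Metric.totallyBounded_iff.1 hK.totallyBounded (ε / 2) (half_pos hε)
    obtain ⟨N, hN⟩ := eventually_atTop.1 (ht.eventually_ge_atTop T)
    refine ⟨c ∪ (fun n => S (t n) (b n)) '' Iio N,
      hc.union ((finite_Iio N).image _), ?_⟩
    rintro _ ⟨n, rfl⟩
    rcases lt_or_ge n N with hn | hn
    · exact mem_iUnion₂.2 ⟨_, Or.inr ⟨n, hn, rfl⟩, mem_ball_self hε⟩
    · obtain ⟨k, hk, hkd⟩ := mem_thickening_iff.1 (hT _ (hN n hn) ⟨_, hb n, rfl⟩)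
      obtain ⟨y, hy, hky⟩ := mem_iUnion₂.1 (hKc hk)
      refine mem_iUnion₂.2 ⟨y, Or.inl hy, ?_⟩
      have := dist_triangle (S (t n) (b n)) k y
      rw [mem_ball] at hky ⊢
      linarith
  have hc : IsCompact (closure (range fun n => S (t n) (b n))) :=
    htb.closure.isCompact_of_isClosed isClosed_closure
  obtain ⟨y, -, φ, hφ, hy⟩ := hc.tendsto_subseq (fun n => subset_closure (mem_range_self n))
  refine ⟨y, ?_, φ, hφ, hy⟩
  refine mem_iInter₂.2 fun u hu => mem_closure_of_tendsto hy ?_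
  filter_upwards [(ht.comp hφ.tendsto_atTop).eventually hu] with n hn
  exact ⟨_, hn, _, hb _, rfl⟩

lemma IsAsymptoticallyCompact.nonempty_omegaLimit [CompleteSpace X]
    (h : IsAsymptoticallyCompact S B) (hB : B.Nonempty) : (omegaLimit atTop S B).Nonempty := by
  obtain ⟨b, hb⟩ := hB
  obtain ⟨y, hy, -⟩ := h.exists_subseq tendsto_natCast_atTop_atTop (b := fun _ => b) fun _ => hb
  exact ⟨y, hy⟩

lemma IsAsymptoticallyCompact.isCompact_omegaLimit [CompleteSpace X]
    (h : IsAsymptoticallyCompact S B) : IsCompact (omegaLimit atTop S B) := by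
  refine IsSeqCompact.isCompact fun y hy => ?_
  choose t ht b hb hd using fun n : ℕ =>
    exists_of_mem_omegaLimit (hy n) (n : ℝ≥0) (Nat.one_div_pos_of_nat (α := ℝ) (n := n))
  have htt : Tendsto t atTop atTop := tendsto_atTop_mono ht tendsto_natCast_atTop_atTop
  obtain ⟨z, hz, φ, hφ, hlim⟩ := h.exists_subseq htt hb
  refine ⟨z, hz, φ, hφ, hlim.congr_dist ?_⟩
  refine squeeze_zero (fun _ => dist_nonneg) (fun n => ?_)
    (tendsto_one_div_add_atTop_nhds_zero_nat.comp hφ.tendsto_atTop)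
  rw [dist_comm]
  exact (hd _).le

lemma IsAsymptoticallyCompact.isFunctionalInvariant_omegaLimit [CompleteSpace X]
    (h : IsAsymptoticallyCompact S B) : IsFunctionalInvariant S (omegaLimit atTop S B) := by
  intro s
  refine Subset.antisymm (image_subset_iff.2 <|
    S.isInvariant_omegaLimit atTop B (fun t => tendsto_atTop_mono (fun _ => le_add_self) tendsto_id) s) ?_
  intro x hx
  choose t ht b hb hd using fun n : ℕ =>
    exists_of_mem_omegaLimit hx (s + n : ℝ≥0) (Nat.one_div_pos_of_nat (α := ℝ) (n := n))
  have htt : Tendsto (fun n => t n - s) atTop atTop :=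
    tendsto_atTop_mono (fun n => le_tsub_of_add_le_left (ht n)) tendsto_natCast_atTop_atTop
  obtain ⟨y, hy, φ, hφ, hlim⟩ := h.exists_subseq htt hb
  refine ⟨y, hy, ?_⟩
  have h1 : Tendsto (fun n => S (t (φ n)) (b (φ n))) atTop (𝓝 (S s y)) := by
    have := ((S.continuous_toFun s).tendsto y).comp hlim
    refine this.congr fun n => ?_
    have hs : s ≤ t (φ n) := le_self_add.trans (ht _)
    simp only [Function.comp_apply]
    rw [← S.map_add, add_tsub_cancel_of_le hs]
  have h2 : Tendsto (fun n => S (t (φ n)) (b (φ n))) atTop (𝓝 x) := by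
    rw [tendsto_iff_dist_tendsto_zero]
    refine squeeze_zero (fun _ => dist_nonneg) (fun n => ?_)
      (tendsto_one_div_add_atTop_nhds_zero_nat.comp hφ.tendsto_atTop)
    rw [dist_comm]
    exact (hd _).le
  exact tendsto_nhds_unique h1 h2

lemma IsAsymptoticallyCompact.attracts_omegaLimit [CompleteSpace X]
    (h : IsAsymptoticallyCompact S B) {η : ℝ} (hη : 0 < η) :
    ∃ T : ℝ≥0, ∀ t : ℝ≥0, T ≤ t → S t '' B ⊆ thickening η (omegaLimit atTop S B) := by
  by_contra! hcon
  choose t ht hnot using fun n : ℕ => hcon n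
  choose x hx hxn using fun n => not_subset.1 (hnot n)
  choose b hb hbx using hx
  have htt : Tendsto t atTop atTop := tendsto_atTop_mono ht tendsto_natCast_atTop_atTop
  obtain ⟨y, hy, φ, hφ, hlim⟩ := h.exists_subseq htt hb
  obtain ⟨n, hn⟩ := (hlim.eventually (ball_mem_nhds y hη)).exists
  refine hxn (φ n) (mem_thickening_iff.2 ⟨y, hy, ?_⟩)
  rw [← hbx]
  exact hn

/-- The `ω`-limit set of an absorbing, asymptotically compact bounded set is a global attractor. -/
theorem isGlobalAttractor_omegaLimit [CompleteSpace X]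
    (habs : IsAbsorbing S B) (h : IsAsymptoticallyCompact S B) :
    IsGlobalAttractor S (omegaLimit atTop S B) where
  isCompact := h.isCompact_omegaLimit
  invariant := h.isFunctionalInvariant_omegaLimit
  attracts := by
    intro C hC η hη
    obtain ⟨t₀, ht₀⟩ := habs C hC
    obtain ⟨T, hT⟩ := h.attracts_omegaLimit hη
    refine ⟨T + t₀, fun t ht => ?_⟩
    rintro _ ⟨c, hc, rfl⟩
    refine hT (t - t₀) (le_tsub_of_add_le_right ht) ⟨S t₀ c, ht₀ t₀ le_rfl ⟨c, hc, rfl⟩, ?_⟩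
    rw [← S.map_add, tsub_add_cancel_of_le (le_add_self.trans ht)]

/-- A global attractor contains every bounded invariant set. -/
theorem IsGlobalAttractor.isGreatest {A : Set X} (hA : IsGlobalAttractor S A) :
    IsGreatest {Y : Set X | Bornology.IsBounded Y ∧ IsFunctionalInvariant S Y} A := by
  refine ⟨⟨hA.isCompact.isBounded, hA.invariant⟩, fun Y hY => ?_⟩
  rw [← hA.isCompact.isClosed.closure_eq, closure_eq_iInter_thickening]
  refine subset_iInter₂ fun η hη => ?_
  obtain ⟨T, hT⟩ := hA.attracts Y hY.1 η hη
  simpa only [hY.2 T] using hT T le_rfl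

/-- A global attractor contained in a bounded connected set is connected. -/
theorem IsGlobalAttractor.isPreconnected {A : Set X} (hA : IsGlobalAttractor S A)
    (hB : Bornology.IsBounded B) (hBc : IsPreconnected B) (hAB : A ⊆ B) : IsPreconnected A := by
  rw [isPreconnected_iff_subset_of_fully_disjoint_closed hA.isCompact.isClosed]
  intro u v hu hv hAuv huv
  -- A splitting of `A` into two closed pieces would split a neighbourhood of `A`, hence `S(t) B`.
  obtain ⟨η, hη, hd⟩ := (huv.mono inter_subset_right inter_subset_right :
    Disjoint (A ∩ u) (A ∩ v)).exists_thickenings (hA.isCompact.inter_right hu)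
      (hA.isCompact.isClosed.inter hv)
  obtain ⟨T, hT⟩ := hA.attracts B hB η hη
  have hpc : IsPreconnected (S T '' B) := hBc.image _ (S.continuous_toFun T).continuousOn
  have hAS : A ⊆ S T '' B := by
    conv_lhs => rw [← hA.invariant T]
    exact image_mono hAB
  have hsub : S T '' B ⊆ thickening η (A ∩ u) ∪ thickening η (A ∩ v) := by
    rw [← thickening_union, ← inter_union_distrib_left, inter_eq_left.2 hAuv]
    exact hT T le_rfl
  have key := isPreconnected_iff_subset_of_disjoint.1 hpc _ _ isOpen_thickening isOpen_thickening
    hsub (by rw [hd.inter_eq, inter_empty])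
  refine key.imp (fun hk x hx => ?_) (fun hk x hx => ?_)
  · refine (hAuv hx).resolve_right fun hxv => ?_
    exact disjoint_left.1 hd (hk (hAS hx)) (self_subset_thickening hη _ ⟨hx, hxv⟩)
  · refine (hAuv hx).resolve_left fun hxu => ?_
    exact disjoint_left.1 hd (self_subset_thickening hη _ ⟨hx, hxu⟩) (hk (hAS hx))

/-- A bounded invariant set lies in every absorbing set. -/
lemma IsFunctionalInvariant.subset_of_isAbsorbing {Y : Set X} (hY : IsFunctionalInvariant S Y)
    (hYb : Bornology.IsBounded Y) (habs : IsAbsorbing S B) : Y ⊆ B := by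
  obtain ⟨t₀, ht₀⟩ := habs Y hYb
  simpa only [hY t₀] using ht₀ t₀ le_rfl

end Attractor

/-! ### Solutions of the lattice equation -/

lemma isSolution_iff {δ σ : ℝ} (hσ : 0 ≤ σ) {g u₀ : Ell2} {u : ℝ → Ell2} :
    IsSolution δ σ g u₀ u ↔ u 0 = u₀ ∧ IsTrajectory (field δ σ hσ g) u := by
  have huniq := uniqueDiffOn_Ici (0 : ℝ)
  constructor
  · intro h
    refine ⟨h.initial, fun t ht => ?_⟩
    have h1 := ((h.contDiffOn.differentiableOn one_ne_zero) t ht).hasDerivWithinAt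
    rwa [(eq_field_iff hσ).1 (h.equation t ht)] at h1
  · rintro ⟨h0, h⟩
    have hd : ∀ t ∈ Ici (0 : ℝ), derivWithin u (Ici 0) t = field δ σ hσ g (u t) := fun t ht =>
      (h t ht).derivWithin (huniq t ht)
    refine ⟨?_, h0, fun t ht => (eq_field_iff hσ).2 (hd t ht)⟩
    rw [contDiffOn_one_iff_derivWithin huniq]
    refine ⟨fun t ht => (h t ht).differentiableWithinAt, ContinuousOn.congr ?_ hd⟩
    have hF : Continuous (field δ σ hσ g) := by
      refine continuous_iff_continuousAt.2 fun v => ?_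
      obtain ⟨K, hK⟩ := exists_lipschitzOnWith_field δ hσ g (‖v‖ + 1)
      exact hK.continuousOn.continuousAt (closedBall_mem_nhds_of_mem
        (mem_ball_zero_iff.2 (lt_add_one _)))
    exact hF.comp_continuousOn h.continuousOn

lemma re_inner_field_le {δ σ : ℝ} (hσ : 0 ≤ σ) (g u : Ell2) :
    (inner ℂ u (field δ σ hσ g u)).re ≤ -δ * ‖u‖ ^ 2 + ‖g‖ * ‖u‖ := by
  have h1 : ∀ n : ℤ, |(fun _ => 1 : ℤ → ℝ) n| ≤ 1 := by simp
  have hw : ∀ v : Ell2, weight (fun _ => 1) h1 v = v := fun v => lp.ext <| funext fun n => by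
    simp
  simpa [hw] using re_inner_weight_field_le (δ := δ) hσ g h1 (κ := 0) (by simp) u

/-- The tail estimate: the second term on the right is small if `θ` varies slowly and vanishes on the
sites that carry most of `g`. -/
lemma IsTrajectory.norm_sq_weight_le {δ σ : ℝ} (hδ : 0 < δ) (hσ : 0 ≤ σ) {g : Ell2} {u : ℝ → Ell2}
    (hu : IsTrajectory (field δ σ hσ g) u) {θ : ℤ → ℝ} (hθ : ∀ n, |θ n| ≤ 1) {κ : ℝ}
    (hk : ∀ n, |θ n - θ (n + 1)| ≤ κ) {ρ : ℝ} (hρ : ∀ t, 0 ≤ t → ‖u t‖ ≤ ρ) {t : ℝ} (ht : 0 ≤ t) :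
    ‖weight θ hθ (u t)‖ ^ 2 ≤
      Real.exp (-δ * t) * ‖u 0‖ ^ 2 + ((‖weight θ hθ g‖ + 2 * κ * ρ) / δ) ^ 2 := by
  have hκ : 0 ≤ κ := (abs_nonneg _).trans (hk 0)
  have h := hu.norm_sq_le ((weight θ hθ).restrictScalars ℝ) (γ := ‖weight θ hθ g‖ + 2 * κ * ρ) hδ
    (T := t) (fun s hs => (re_inner_weight_field_le hσ g hθ hk (u s)).trans (by
      have := hρ s hs.1
      simp only [ContinuousLinearMap.coe_restrictScalars']
      gcongr)) t ⟨ht, le_rfl⟩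
  simp only [ContinuousLinearMap.coe_restrictScalars'] at h
  refine h.trans ?_
  gcongr
  exact norm_weight_le hθ _

lemma IsTrajectory.norm_sq_field_le {δ σ : ℝ} (hδ : 0 < δ) (hσ : 0 ≤ σ) {g : Ell2} {u : ℝ → Ell2}
    (hu : IsTrajectory (field δ σ hσ g) u) {t : ℝ} (ht : 0 ≤ t) :
    ‖u t‖ ^ 2 ≤ Real.exp (-δ * t) * ‖u 0‖ ^ 2 + (‖g‖ / δ) ^ 2 :=
  hu.norm_sq_le (ContinuousLinearMap.id ℝ Ell2) hδ (T := t)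
    (fun s _ => re_inner_field_le hσ g (u s)) t ⟨ht, le_rfl⟩

lemma IsTrajectory.norm_field_le {δ σ ρ : ℝ} (hδ : 0 < δ) (hσ : 0 ≤ σ) {g : Ell2} {u : ℝ → Ell2}
    (hu : IsTrajectory (field δ σ hσ g) u) (h0 : ‖u 0‖ ≤ ρ) {t : ℝ} (ht : 0 ≤ t) :
    ‖u t‖ ≤ Real.sqrt (ρ ^ 2 + (‖g‖ / δ) ^ 2) := by
  refine Real.le_sqrt_of_sq_le ((hu.norm_sq_field_le hδ hσ ht).trans ?_)
  have he : Real.exp (-δ * t) ≤ 1 := Real.exp_le_one_iff.2 (by nlinarith)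
  have h1 : ‖u 0‖ ^ 2 ≤ ρ ^ 2 := pow_le_pow_left₀ (norm_nonneg _) h0 2
  nlinarith [sq_nonneg ‖u 0‖]

/-! ### The absorbing ball -/

lemma exists_exp_mul_lt {δ : ℝ} (hδ : 0 < δ) (C : ℝ) {ε : ℝ} (hε : 0 < ε) :
    ∃ T : ℝ≥0, ∀ t : ℝ≥0, T ≤ t → Real.exp (-δ * t) * C < ε := by
  have h1 : Tendsto (fun t : ℝ≥0 => Real.exp (-δ * t) * C) atTop (𝓝 (0 * C)) := by
    refine (Real.tendsto_exp_atBot.comp ?_).mul_const C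
    exact (NNReal.tendsto_coe_atTop.2 tendsto_id).const_mul_atTop_of_neg (neg_lt_zero.2 hδ)
  rw [zero_mul] at h1
  exact eventually_atTop.1 (h1.eventually_lt_const hε)

lemma isAbsorbing_closedBall {δ σ : ℝ} (hδ : 0 < δ) (hσ : 0 ≤ σ) {g : Ell2} {S : Flow ℝ≥0 Ell2}
    (hS : IsSolutionSemigroup δ σ g S) {ρ : ℝ} (hρ : ‖g‖ / δ < ρ) :
    IsAbsorbing S (closedBall 0 ρ) := by
  intro B hB
  obtain ⟨C, hC⟩ := hB.exists_norm_le
  have h0 : 0 ≤ ‖g‖ / δ := by positivity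
  obtain ⟨T, hT⟩ := exists_exp_mul_lt hδ (C ^ 2)
    (sub_pos.2 (pow_lt_pow_left₀ hρ h0 two_ne_zero))
  refine ⟨T, fun t ht => ?_⟩
  rintro _ ⟨b, hb, rfl⟩
  obtain ⟨hu0, hu⟩ := (isSolution_iff hσ).1 ((hS b fun r => S r.toNNReal b).2 fun r => by simp)
  have h1 := hu.norm_sq_field_le hδ hσ t.2
  simp only [Real.toNNReal_coe, NNReal.val_eq_coe] at h1
  rw [hu0] at h1
  have h2 : ‖b‖ ^ 2 ≤ C ^ 2 := pow_le_pow_left₀ (norm_nonneg _) (hC b hb) 2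
  have h3 := mul_le_mul_of_nonneg_left h2 (Real.exp_pos (-δ * t)).le
  rw [mem_closedBall_zero_iff]
  refine (sq_le_sq₀ (norm_nonneg _) (h0.trans hρ.le)).1 ?_
  linarith [hT t ht]

/-! ### Tail estimates and asymptotic compactness -/

/-- The cut-off weight: `0` for `|n| ≤ k`, `1` for `|n| ≥ 2k`, and linear in `|n|` in between. -/
noncomputable def cutoff (k : ℕ) (n : ℤ) : ℝ := min 1 (max 0 (|(n : ℝ)| / k - 1))

lemma cutoff_nonneg (k : ℕ) (n : ℤ) : 0 ≤ cutoff k n :=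
  le_min zero_le_one (le_max_left _ _)

lemma abs_cutoff_le (k : ℕ) (n : ℤ) : |cutoff k n| ≤ 1 := by
  rw [abs_of_nonneg (cutoff_nonneg k n)]
  exact min_le_left _ _

lemma cutoff_eq_zero {k : ℕ} {n : ℤ} (h : |(n : ℝ)| ≤ k) : cutoff k n = 0 := by
  have h1 : |(n : ℝ)| / k - 1 ≤ 0 := sub_nonpos.2 (div_le_one_of_le₀ h k.cast_nonneg)
  rw [cutoff, max_eq_left h1, min_eq_right zero_le_one]

lemma cutoff_eq_one {k : ℕ} (hk : 0 < k) {n : ℤ} (h : 2 * (k : ℝ) ≤ |(n : ℝ)|) :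
    cutoff k n = 1 := by
  have hk' : (0 : ℝ) < k := by exact_mod_cast hk
  have h1 : 1 ≤ |(n : ℝ)| / k - 1 := by
    have := (le_div_iff₀ hk').2 h
    linarith
  rw [cutoff, max_eq_right (zero_le_one.trans h1), min_eq_left h1]

lemma abs_cutoff_sub_le (k : ℕ) (n : ℤ) : |cutoff k n - cutoff k (n + 1)| ≤ 1 / k := by
  refine (abs_min_sub_min_le_max _ _ _ _).trans ?_
  rw [sub_self, abs_zero, max_eq_right (abs_nonneg _)]
  refine (abs_max_sub_max_le_max _ _ _ _).trans ?_
  rw [sub_self, abs_zero, max_eq_right (abs_nonneg _), sub_sub_sub_cancel_right, ← sub_div, abs_div,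
    abs_of_nonneg (k.cast_nonneg : (0 : ℝ) ≤ k)]
  gcongr
  refine (abs_abs_sub_abs_le _ _).trans ?_
  simp

/-- The finite section of a sequence over a finite set of sites. -/
noncomputable def finiteSection (s : Finset ℤ) (u : Ell2) : Ell2 := ∑ n ∈ s, lp.single 2 n (u n)

lemma finiteSection_apply (s : Finset ℤ) (u : Ell2) (n : ℤ) :
    finiteSection s u n = if n ∈ s then u n else 0 := by
  rw [finiteSection, lp.coeFn_sum]
  refine (Finset.sum_apply n s fun i => (lp.single 2 i (u i) : Ell2).1).trans ?_
  have h : ∀ i, (lp.single 2 i (u i) : Ell2) n = if n = i then u n else 0 := fun i => by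
    rw [lp.single_apply, Pi.single_apply]
    split_ifs with hi
    · rw [hi]
    · rfl
  simp only [h]
  exact Finset.sum_ite_eq s n fun _ => u n

lemma tendsto_norm_weight_cutoff (g : Ell2) :
    Tendsto (fun k => ‖weight (cutoff k) (abs_cutoff_le k) g‖) atTop (𝓝 0) := by
  refine Metric.tendsto_atTop.2 fun ε hε => ?_
  obtain ⟨s, hs⟩ := (Metric.tendsto_atTop.1 (lp.hasSum_single (p := 2) (by norm_num) g)) ε hε
  refine ⟨s.sup Int.natAbs, fun k hk => ?_⟩
  rw [Real.dist_0_eq_abs, abs_norm]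
  refine lt_of_le_of_lt ?_ (hs s le_rfl)
  rw [dist_comm, dist_eq_norm]
  refine lp.norm_mono two_ne_zero fun n => ?_
  rw [lp.coeFn_sub, Pi.sub_apply, weight_apply, norm_mul, Complex.norm_real, Real.norm_eq_abs]
  change _ ≤ ‖g n - finiteSection s g n‖
  rw [finiteSection_apply]
  split_ifs with hn
  · have h1 : |(n : ℝ)| ≤ k := by
      rw [← Int.cast_abs, Int.abs_eq_natAbs, Int.cast_natCast]
      exact_mod_cast (Finset.le_sup (f := Int.natAbs) hn).trans hk
    simp [cutoff_eq_zero h1]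
  · rw [sub_zero]
    exact mul_le_of_le_one_left (norm_nonneg _) (abs_cutoff_le k n)

lemma norm_sub_finiteSection_le {k : ℕ} (hk : 0 < k) (u : Ell2) :
    ‖u - finiteSection (Finset.Icc (-(2 * k : ℤ)) (2 * k)) u‖ ≤
      ‖weight (cutoff k) (abs_cutoff_le k) u‖ := by
  refine lp.norm_mono two_ne_zero fun n => ?_
  rw [lp.coeFn_sub, Pi.sub_apply, weight_apply, norm_mul, Complex.norm_real, finiteSection_apply]
  split_ifs with hn
  · rw [sub_self, norm_zero]
    positivity
  · have h1 : 2 * (k : ℤ) ≤ |n| := by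
      rw [Finset.mem_Icc, ← abs_le] at hn
      exact (not_le.1 hn).le
    have h2 : 2 * (k : ℝ) ≤ |(n : ℝ)| := by exact_mod_cast h1
    simp [cutoff_eq_one hk h2]

/-- Finite sections of a ball range in a compact set. -/
lemma exists_isCompact_finiteSection (s : Finset ℤ) (ρ : ℝ) :
    ∃ K : Set Ell2, IsCompact K ∧ ∀ u : Ell2, ‖u‖ ≤ ρ → finiteSection s u ∈ K := by
  have hcont : Continuous fun c : s → ℂ =>
      ∑ n : s, (lp.single 2 (n : ℤ) (c n) : Ell2) :=
    continuous_finsetSum _ fun n _ =>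
      (lp.isometry_single (E := fun _ : ℤ => ℂ) (p := 2) (n : ℤ)).continuous.comp
        (continuous_apply n)
  refine ⟨_, (isCompact_univ_pi fun _ : s => isCompact_closedBall (0 : ℂ) ρ).image hcont,
    fun u hu => ⟨fun n => u n, fun n _ => ?_, ?_⟩⟩
  · exact mem_closedBall_zero_iff.2 ((norm_coord_le u n).trans hu)
  · exact Finset.sum_coe_sort s fun n => (lp.single 2 n (u n) : Ell2)

lemma isAsymptoticallyCompact_closedBall {δ σ : ℝ} (hδ : 0 < δ) (hσ : 0 ≤ σ) {g : Ell2}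
    {S : Flow ℝ≥0 Ell2} (hS : IsSolutionSemigroup δ σ g S) (ρ : ℝ) :
    IsAsymptoticallyCompact S (closedBall 0 ρ) := by
  intro ε hε
  set ρ' := Real.sqrt (ρ ^ 2 + (‖g‖ / δ) ^ 2)
  -- The forcing of the tail vanishes as the cut-off moves to infinity.
  have hlim : Tendsto (fun k : ℕ => ((‖weight (cutoff k) (abs_cutoff_le k) g‖
      + 2 * (1 / k) * ρ') / δ) ^ 2) atTop (𝓝 (((0 + 2 * 0 * ρ') / δ) ^ 2)) :=
    ((((tendsto_norm_weight_cutoff g).add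
      ((tendsto_one_div_atTop_nhds_zero_nat.const_mul 2).mul_const ρ')).div_const δ).pow 2)
  rw [mul_zero, zero_mul, add_zero, zero_div, zero_pow two_ne_zero] at hlim
  obtain ⟨k, hk, hk0⟩ := ((hlim.eventually_lt_const (by positivity : 0 < ε ^ 2 / 2)).and
    (eventually_gt_atTop 0)).exists
  obtain ⟨T, hT⟩ := exists_exp_mul_lt hδ (ρ ^ 2) (by positivity : 0 < ε ^ 2 / 2)
  obtain ⟨K, hK, hKmem⟩ :=
    exists_isCompact_finiteSection (Finset.Icc (-(2 * k : ℤ)) (2 * k)) ρ'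
  refine ⟨K, hK, T, fun t ht => ?_⟩
  rintro _ ⟨b, hb, rfl⟩
  rw [mem_closedBall_zero_iff] at hb
  obtain ⟨hu0, hu⟩ := (isSolution_iff hσ).1 ((hS b fun r => S r.toNNReal b).2 fun r => by simp)
  rw [← hu0] at hb
  have hbd := fun r (hr : 0 ≤ r) => hu.norm_field_le hδ hσ hb hr
  have h1 := hu.norm_sq_weight_le hδ hσ (abs_cutoff_le k) (abs_cutoff_sub_le k) hbd t.2
  have h2 := hbd t t.2
  simp only [Real.toNNReal_coe, NNReal.val_eq_coe] at h1 h2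
  refine mem_thickening_iff.2 ⟨_, hKmem _ h2, ?_⟩
  rw [dist_eq_norm]
  refine (norm_sub_finiteSection_le hk0 _).trans_lt ?_
  refine (sq_lt_sq₀ (norm_nonneg _) hε.le).1 ?_
  have h4 := mul_le_mul_of_nonneg_left (pow_le_pow_left₀ (norm_nonneg _) hb 2)
    (Real.exp_pos (-δ * t)).le
  linarith [hT t ht]

end DNLS

open DNLS in
theorem theorem5p1 (δ σ : ℝ) (hδ : 0 < δ) (hσ : 0 ≤ σ) (g : DNLS.Ell2) :
    ∃ S : Flow ℝ≥0 DNLS.Ell2, DNLS.IsSolutionSemigroup δ σ g S ∧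
      ∃ A : Set DNLS.Ell2,
        DNLS.IsGlobalAttractor S A ∧
        IsConnected A ∧
        IsGreatest {Y : Set DNLS.Ell2 |
          Bornology.IsBounded Y ∧ DNLS.IsFunctionalInvariant S Y} A ∧
        ∀ ρ₁ : ℝ, ‖g‖ / δ < ρ₁ →
          DNLS.IsAbsorbing S (Metric.closedBall 0 ρ₁) ∧
          A = omegaLimit Filter.atTop S (Metric.closedBall 0 ρ₁) ∧
          A ⊆ Metric.closedBall 0 ρ₁ := by
  obtain ⟨S, hS⟩ := exists_flow_of_dissipative hδ (exists_lipschitzOnWith_field δ hσ g)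
    (re_inner_field_le hσ g)
  have hSS : IsSolutionSemigroup δ σ g S := fun u₀ u => (isSolution_iff hσ).trans (hS u₀ u)
  have hattr : ∀ ρ : ℝ, ‖g‖ / δ < ρ →
      IsGlobalAttractor S (omegaLimit Filter.atTop S (Metric.closedBall 0 ρ)) := fun ρ hρ =>
    isGlobalAttractor_omegaLimit (isAbsorbing_closedBall hδ hσ hSS hρ)
      (isAsymptoticallyCompact_closedBall hδ hσ hSS ρ)
  set ρ := ‖g‖ / δ + 1
  have hρ : ‖g‖ / δ < ρ := lt_add_one _
  have hA := hattr ρ hρ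
  have hne : (Metric.closedBall (0 : Ell2) ρ).Nonempty :=
    Metric.nonempty_closedBall.2 ((by positivity : 0 ≤ ‖g‖ / δ).trans hρ.le)
  refine ⟨S, hSS, _, hA, ⟨?_, ?_⟩, hA.isGreatest, fun ρ₁ hρ₁ => ?_⟩
  · exact (isAsymptoticallyCompact_closedBall hδ hσ hSS ρ).nonempty_omegaLimit hne
  · exact hA.isPreconnected Metric.isBounded_closedBall (convex_closedBall 0 ρ).isPreconnected
      (hA.invariant.subset_of_isAbsorbing hA.isCompact.isBounded
        (isAbsorbing_closedBall hδ hσ hSS hρ))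
  · have habs := isAbsorbing_closedBall hδ hσ hSS hρ₁
    exact ⟨habs, hA.isGreatest.unique (hattr ρ₁ hρ₁).isGreatest,
      hA.invariant.subset_of_isAbsorbing hA.isCompact.isBounded habs⟩
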